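/- Let $\mathcal T$ be either the category $\mathbf{Top}$ of topological spaces and continuous maps (with free homotopies), or the category $\mathbf{Top^w}$ of well-pointed spaces (the inclusion of the base point is a closed cofibration) and base-point-preserving continuous maps (with pointed homotopies). Write $\simeq$ for homotopy in $\mathcal T$. A square $q\colon P\to X$, $p\colon P\to A$, $f\colon X\to Y$, $\iota\colon A\to Y$ in $\mathcal T$ is a homotopy pullback if there is a homotopy from $f\circ q$ to $\iota\circ p$ such that the induced map from $P$ to $\{(x,\omega,a)\in X\times Y^{[0,1]}\times A : \omega(0)=f(x),\ \omega(1)=\iota(a)\}$ is a homotopy equivalence (pointed in the case of $\mathbf{Top^w}$). Let $\mathrm{secat}$ be any assignment of a value $\mathrm{secat}(\iota)\in\mathbb N\cup\{\infty\}$ to each map $\iota\colon A\to Y$ in $\mathcal T$ such that (S0) $\mathrm{secat}(\iota)=0$ if and only if there is a map $s\colon Y\to A$ with $\iota\circ s\simeq \mathrm{id}_Y$; (S1) if $\iota\colon A\to X$, $\kappa\colon B\to X$, $\zeta\colon B\to A$ satisfy $\iota\circ\zeta\simeq\kappa$, then $\mathrm{secat}(\iota)\le\mathrm{secat}(\kappa)$;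 (S2) if $(q,p,f,\iota)$ is a homotopy pullback as above, then $\mathrm{secat}(q)\le\mathrm{secat}(\iota)$. For maps $f\colon X\to Y$ and $\iota\colon A\to Y$ in $\mathcal T$, the lifting category is $\mathrm{liftcat}_f(\iota)=\mathrm{secat}(q)$, where $(q,p,f,\iota)$ is any homotopy pullback of $f$ and $\iota$ in $\mathcal T$ (the value does not depend on the choice). Let $\kappa\colon B\to X$, $\zeta\colon B\to A$, $\iota\colon A\to Y$, $f\colon X\to Y$, $g\colon W\to X$, $h\colon W\to Y$ be maps in $\mathcal T$ with $f\circ\kappa\simeq\iota\circ\zeta$ and $h\simeq f\circ g$. Then $$\mathrm{liftcat}_h(\iota)\le\mathrm{liftcat}_g(\kappa).$$ If in addition the square $(\kappa,\zeta,f,\iota)$ is a homotopy pullback, then $\mathrm{liftcat}_h(\iota)=\mathrm{liftcat}_g(\kappa)$. In particular, if $f$ and $\zeta$ are homotopy equivalences in $\mathcal T$, then the square is a homotopy pullback and $\mathrm{liftcat}_h(\iota)=\mathrm{liftcat}_g(\kappa)$. Consequently, if $g,h\colon W\to Y$ and $\iota,\kappa\colon A\to Y$ are maps in $\mathcal T$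 with $h\simeq g$ and $\iota\simeq\kappa$, then $\mathrm{liftcat}_h(\iota)=\mathrm{liftcat}_g(\kappa)$. -/

import Mathlib

open scoped unitInterval

universe u

/-- The standard (double mapping path space) homotopy pullback of `f : X → Y` and `ι : A → Y`:
triples `(x, ω, a)` with `ω` a path in `Y` from `f x` to `ι a`, topologized as a subspace of
`X × Y^I × A`, where `Y^I` has the compact-open topology. -/
def StdHPullback {X A Y : Type u} [TopologicalSpace X] [TopologicalSpace A] [TopologicalSpace Y]
    (f : C(X, Y)) (ι : C(A, Y)) : Type u :=
  {z : X × C(I, Y) × A // z.2.1 0 = f z.1 ∧ z.2.1 1 = ι z.2.2}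

instance {X A Y : Type u} [TopologicalSpace X] [TopologicalSpace A] [TopologicalSpace Y]
    (f : C(X, Y)) (ι : C(A, Y)) : TopologicalSpace (StdHPullback f ι) :=
  instTopologicalSpaceSubtype

namespace StdHPullback

variable {X A Y P : Type u} [TopologicalSpace X] [TopologicalSpace A] [TopologicalSpace Y]
  [TopologicalSpace P]

/-- The projection to `X`. -/
def fst (f : C(X, Y)) (ι : C(A, Y)) : C(StdHPullback f ι, X) where
  toFun z := z.1.1
  continuous_toFun := continuous_fst.comp continuous_subtype_val

/-- The whisker map `b ↦ (q b, H(-, b), p b)` induced by a square `(q, p, f, ι)` together with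
a homotopy `H` from `f ∘ q` to `ι ∘ p`. -/
def whisker {f : C(X, Y)} {ι : C(A, Y)} {q : C(P, X)} {p : C(P, A)}
    (H : (f.comp q).Homotopy (ι.comp p)) : C(P, StdHPullback f ι) where
  toFun b := ⟨(q b, (H.toContinuousMap.comp ContinuousMap.prodSwap).curry b, p b),
    by simp [ContinuousMap.prodSwap]⟩
  continuous_toFun := by
    refine Continuous.subtype_mk ?_ _
    exact q.continuous.prodMk ((ContinuousMap.continuous _).prodMk p.continuous)

end StdHPullback

/-! ### The category `Top`: all topological spaces, continuous maps, free homotopies -/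

namespace FreeTop

/-- `f` is a homotopy equivalence. -/
def IsHEquiv {X Y : Type u} [TopologicalSpace X] [TopologicalSpace Y] (f : C(X, Y)) : Prop :=
  ∃ e : ContinuousMap.HomotopyEquiv X Y, e.toFun = f

/-- The square with `q : P → X`, `p : P → A`, `f : X → Y`, `ι : A → Y` is a homotopy pullback:
it commutes up to a homotopy whose whisker map to the standard homotopy pullback of `f` and `ι`
is a homotopy equivalence. -/
def IsHPullback {P X A Y : Type u} [TopologicalSpace P] [TopologicalSpace X]
    [TopologicalSpace A] [TopologicalSpace Y]
    (q : C(P, X)) (p : C(P, A)) (f : C(X, Y)) (ι : C(A, Y)) : Prop :=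
  ∃ H : (f.comp q).Homotopy (ι.comp p), IsHEquiv (StdHPullback.whisker H)

/-- An (abstract) sectional category on `Top`: an invariant of continuous maps, with values in
the natural numbers extended by `∞`, that satisfies the axioms `S0`, `S1`, `S2`. -/
structure SectionalCategory where
  /-- the invariant -/
  secat : ∀ {A Y : Type u} [TopologicalSpace A] [TopologicalSpace Y], C(A, Y) → ℕ∞
  S0 : ∀ {A Y : Type u} [TopologicalSpace A] [TopologicalSpace Y] (ι : C(A, Y)),
    secat ι = 0 ↔ ∃ s : C(Y, A), (ι.comp s).Homotopic (ContinuousMap.id Y)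
  S1 : ∀ {A B X : Type u} [TopologicalSpace A] [TopologicalSpace B] [TopologicalSpace X]
    (ι : C(A, X)) (κ : C(B, X)) (ζ : C(B, A)), (ι.comp ζ).Homotopic κ → secat ι ≤ secat κ
  S2 : ∀ {P X A Y : Type u} [TopologicalSpace P] [TopologicalSpace X] [TopologicalSpace A]
    [TopologicalSpace Y] (q : C(P, X)) (p : C(P, A)) (f : C(X, Y)) (ι : C(A, Y)),
    IsHPullback q p f ι → secat q ≤ secat ι

/-- The lifting category `liftcat_f(ι)`: the value `secat q` for a homotopy pullback
`(q, p, f, ι)` of `f` and `ι`. All homotopy pullbacks of `f` and `ι` give the same value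
(`liftcat_eq` below), so the set below has exactly one element. -/
noncomputable def SectionalCategory.liftcat (S : SectionalCategory.{u}) {X A Y : Type u}
    [TopologicalSpace X] [TopologicalSpace A] [TopologicalSpace Y]
    (f : C(X, Y)) (ι : C(A, Y)) : ℕ∞ :=
  sInf {n | ∃ (P : Type u) (_ : TopologicalSpace P) (q : C(P, X)) (p : C(P, A)),
    IsHPullback q p f ι ∧ n = S.secat q}

theorem IsHPullback.exists_whisker {P X A Y Z : Type u} [TopologicalSpace P]
    [TopologicalSpace X] [TopologicalSpace A] [TopologicalSpace Y] [TopologicalSpace Z]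
    {q : C(P, X)} {p : C(P, A)} {f : C(X, Y)} {ι : C(A, Y)} (h : IsHPullback q p f ι)
    (x : C(Z, X)) (a : C(Z, A)) (K : (f.comp x).Homotopic (ι.comp a)) :
    ∃ s : C(Z, P), (q.comp s).Homotopic x := by
  obtain ⟨H, e, he⟩ := h
  obtain ⟨K⟩ := K
  refine ⟨e.invFun.comp (StdHPullback.whisker K), ?_⟩
  have h1 := e.right_inv
  rw [he] at h1
  exact (ContinuousMap.Homotopic.refl (StdHPullback.fst f ι)).comp
    (h1.comp (ContinuousMap.Homotopic.refl (StdHPullback.whisker K)))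

theorem SectionalCategory.liftcat_eq (S : SectionalCategory.{u}) {P X A Y : Type u}
    [TopologicalSpace P] [TopologicalSpace X] [TopologicalSpace A] [TopologicalSpace Y]
    {q : C(P, X)} {p : C(P, A)} {f : C(X, Y)} {ι : C(A, Y)} (h : IsHPullback q p f ι) :
    S.liftcat f ι = S.secat q := by
  apply le_antisymm
  · exact sInf_le ⟨P, _, q, p, h, rfl⟩
  · refine le_sInf ?_
    rintro n ⟨P', _, q', p', h', rfl⟩
    obtain ⟨s, hs⟩ := h.exists_whisker q' p' ⟨h'.choose⟩
    exact S.S1 _ _ s hs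

end FreeTop

/-! ### The category `Top^w`: well-pointed spaces, pointed maps, pointed homotopies -/

/-- The map `i : A → X` is a closed cofibration: a closed embedding with the homotopy extension
property with respect to all spaces. -/
def IsClosedCofibration {A X : Type u} [TopologicalSpace A] [TopologicalSpace X]
    (i : C(A, X)) : Prop :=
  Topology.IsClosedEmbedding i ∧
    ∀ (Z : Type u) [TopologicalSpace Z] (g : C(X, Z)) (G : C(A × I, Z)),
      (∀ a, G (a, 0) = g (i a)) →
      ∃ F : C(X × I, Z), (∀ x, F (x, 0) = g x) ∧ ∀ a t, F (i a, t) = G (a, t)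

/-- A well-pointed space: the inclusion of the base point is a closed cofibration. -/
structure WPSpace where
  /-- the underlying space -/
  carrier : Type u
  /-- its topology -/
  [top : TopologicalSpace carrier]
  /-- the base point -/
  pt : carrier
  wellPointed : IsClosedCofibration (ContinuousMap.const PUnit.{u + 1} pt)

namespace WPSpace

instance : CoeSort WPSpace.{u} (Type u) := ⟨WPSpace.carrier⟩

instance (X : WPSpace.{u}) : TopologicalSpace X := X.top

/-- Continuous maps preserving base points. -/
structure Map (X Y : WPSpace.{u}) where
  /-- the underlying continuous map -/
  map : C(X, Y)
  map_pt : map X.pt = Y.pt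

/-- The identity. -/
def Map.id (X : WPSpace.{u}) : Map X X := ⟨ContinuousMap.id X, rfl⟩

/-- Composition `g ∘ f`. -/
def Map.comp {X Y Z : WPSpace.{u}} (g : Map Y Z) (f : Map X Y) : Map X Z :=
  ⟨g.map.comp f.map, by simp [f.map_pt, g.map_pt]⟩

/-- Pointed homotopy of pointed maps. -/
def Map.Homotopic {X Y : WPSpace.{u}} (f g : Map X Y) : Prop :=
  f.map.HomotopicRel g.map {X.pt}

/-- `f` is a pointed homotopy equivalence from `(X, x₀)` to `(Y, y₀)`. -/
def IsPointedHEquiv {X Y : Type u} [TopologicalSpace X] [TopologicalSpace Y] (x₀ : X) (y₀ : Y)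
    (f : C(X, Y)) : Prop :=
  f x₀ = y₀ ∧ ∃ g : C(Y, X), g y₀ = x₀ ∧
    (g.comp f).HomotopicRel (ContinuousMap.id X) {x₀} ∧
    (f.comp g).HomotopicRel (ContinuousMap.id Y) {y₀}

/-- A pointed map is a homotopy equivalence in `Top^w`. -/
def Map.IsHEquiv {X Y : WPSpace.{u}} (f : Map X Y) : Prop :=
  IsPointedHEquiv X.pt Y.pt f.map

/-- The base point of the standard homotopy pullback: the two base points and the constant
path. -/
def stdBase {X A Y : WPSpace.{u}} (f : Map X Y) (ι : Map A Y) : StdHPullback f.map ι.map :=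
  ⟨(X.pt, ContinuousMap.const I Y.pt, A.pt), by simp [f.map_pt, ι.map_pt]⟩

/-- The square with `q : P → X`, `p : P → A`, `f : X → Y`, `ι : A → Y` is a homotopy pullback in
`Top^w`: it commutes up to a pointed homotopy whose whisker map to the standard homotopy pullback
of `f` and `ι` is a pointed homotopy equivalence. -/
def IsHPullback {P X A Y : WPSpace.{u}} (q : Map P X) (p : Map P A) (f : Map X Y)
    (ι : Map A Y) : Prop :=
  ∃ H : (f.comp q).map.HomotopyRel (ι.comp p).map {P.pt},
    IsPointedHEquiv P.pt (stdBase f ι)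
      (StdHPullback.whisker (f := f.map) (ι := ι.map) (q := q.map) (p := p.map) H.toHomotopy)

/-- An (abstract) sectional category on `Top^w`: an invariant of pointed maps, with values in
the natural numbers extended by `∞`, that satisfies the axioms `S0`, `S1`, `S2`. -/
structure SectionalCategory where
  /-- the invariant -/
  secat : ∀ {A Y : WPSpace.{u}}, Map A Y → ℕ∞
  S0 : ∀ {A Y : WPSpace.{u}} (ι : Map A Y),
    secat ι = 0 ↔ ∃ s : Map Y A, (ι.comp s).Homotopic (Map.id Y)
  S1 : ∀ {A B X : WPSpace.{u}} (ι : Map A X) (κ : Map B X) (ζ : Map B A),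
    (ι.comp ζ).Homotopic κ → secat ι ≤ secat κ
  S2 : ∀ {P X A Y : WPSpace.{u}} (q : Map P X) (p : Map P A) (f : Map X Y) (ι : Map A Y),
    IsHPullback q p f ι → secat q ≤ secat ι

/-- The lifting category `liftcat_f(ι)`: the value `secat q` for a homotopy pullback
`(q, p, f, ι)` of `f` and `ι` in `Top^w`. All of these give the same value (`liftcat_eq` below),
so the set below has exactly one element (the standard homotopy pullback is well-pointed). -/
noncomputable def SectionalCategory.liftcat (S : SectionalCategory.{u}) {X A Y : WPSpace.{u}}
    (f : Map X Y) (ι : Map A Y) : ℕ∞ :=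
  sInf {n | ∃ (P : WPSpace.{u}) (q : Map P X) (p : Map P A),
    IsHPullback q p f ι ∧ n = S.secat q}

theorem IsHPullback.exists_whisker {P X A Y Z : WPSpace.{u}}
    {q : Map P X} {p : Map P A} {f : Map X Y} {ι : Map A Y} (h : IsHPullback q p f ι)
    (x : Map Z X) (a : Map Z A) (K : (f.comp x).Homotopic (ι.comp a)) :
    ∃ s : Map Z P, (q.comp s).Homotopic x := by
  obtain ⟨H, -, g, hg, -, ⟨G⟩⟩ := h
  obtain ⟨K⟩ := K
  let w : C(Z, StdHPullback f.map ι.map) :=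
    StdHPullback.whisker (q := x.map) (p := a.map) K.toHomotopy
  have hw : w Z.pt = stdBase f ι := by
    apply Subtype.ext
    refine Prod.ext x.map_pt (Prod.ext ?_ a.map_pt)
    ext t
    have := K.eq_fst t (Set.mem_singleton Z.pt)
    refine this.trans ?_
    change f.map (x.map Z.pt) = Y.pt
    rw [x.map_pt, f.map_pt]
  have hg' : (g.comp w) Z.pt = P.pt := by
    rw [ContinuousMap.comp_apply, hw, hg]
  refine ⟨⟨g.comp w, hg'⟩, ⟨⟨(ContinuousMap.Homotopy.refl
    (StdHPullback.fst f.map ι.map)).comp (G.toHomotopy.comp (ContinuousMap.Homotopy.refl w)),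
    ?_⟩⟩⟩
  rintro t z rfl
  have h1 := G.eq_fst t (x := w Z.pt) (Set.mem_singleton_iff.2 hw)
  exact congrArg (StdHPullback.fst f.map ι.map) h1

theorem SectionalCategory.liftcat_eq (S : SectionalCategory.{u}) {P X A Y : WPSpace.{u}}
    {q : Map P X} {p : Map P A} {f : Map X Y} {ι : Map A Y} (h : IsHPullback q p f ι) :
    S.liftcat f ι = S.secat q := by
  apply le_antisymm
  · exact sInf_le ⟨P, q, p, h, rfl⟩
  · refine le_sInf ?_
    rintro n ⟨P', q', p', h', rfl⟩
    obtain ⟨s, hs⟩ := h.exists_whisker q' p' ⟨h'.choose⟩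
    exact S.S1 _ _ s hs

end WPSpace

/-! Both comparisons of lifting categories come from the weak universal property `exists_whisker`
and axiom S1. If `q`, `q'` are homotopy pullbacks of `ι` along `h` and of `κ` along `g`, then h q' ≃
f g q' ≃ f κ p' ≃ ι ζ p', so `q'` factors through `q` up to homotopy, and S1 gives the inequality.
If the square is a homotopy pullback, f g q ≃ h q ≃ ι p factors g q through `κ`, hence `q` through
`q'`, and S1 gives the converse.

The first remaining point is that a square with `f` and `ζ` homotopy equivalences is a homotopy
pullback. The whisker map followed by the projection to `A` is `ζ`, so by two-out-of-three it
suffices that this projection, a base change of `f`, is an equivalence (`isRelHEquiv_snd`). The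
argument is made relative to subsets: empty ones give free homotopies, base points give pointed
ones.

The second is that homotopy pullbacks exist in `Top^w`, that is, that the standard one is
well-pointed; without this the infimum defining `liftcat` could be over the empty set.
Well-pointedness is translated into contracting data (`PointNDR`), and such data for X, A and Y are
assembled into data for the pullback. -/

/-! ### Dragging the initial point of a path -/

section Drag

variable {Y : Type*}

/-- The retraction of the real line onto the unit interval. -/
noncomputable abbrev clampI (r : ℝ) : I := Set.projIcc 0 1 zero_le_one r

theorem continuous_clampI : Continuous clampI := continuous_projIcc

theorem clampI_coe (t : I) : clampI (t : ℝ) = t := Set.projIcc_val _ t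

/-- For paths `δ`, `ω` with the same initial point, `drag δ ω t` is the path that runs
backwards along `δ` from `δ t` to `δ 0` and then along `ω`. -/
noncomputable def drag (δ ω : I → Y) (t s : I) : Y :=
  if 2 * (s : ℝ) ≤ t then δ (clampI (t - 2 * s)) else ω (clampI ((2 * s - t) / (2 - t)))

theorem drag_source (δ ω : I → Y) (t : I) : drag δ ω t 0 = δ t := by
  simp [drag, t.2.1]

theorem drag_target (δ ω : I → Y) (t : I) : drag δ ω t 1 = ω 1 := by
  have ht := t.2.2
  have h : ¬ 2 * ((1 : I) : ℝ) ≤ t := by simp; linarith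
  rw [drag, if_neg h]
  congr 1
  have : (2 * ((1 : I) : ℝ) - t) / (2 - t) = ((1 : I) : ℝ) := by
    simp only [Set.Icc.coe_one, mul_one]
    exact div_self (by linarith)
  rw [this, clampI_coe]

theorem drag_zero {δ ω : I → Y} (h : δ 0 = ω 0) (s : I) : drag δ ω 0 s = ω s := by
  unfold drag
  split_ifs with hs
  · have : s = 0 := le_antisymm (Subtype.coe_le_coe.1 (by simp at hs ⊢; linarith)) s.2.1
    subst this
    simpa using h
  · congr 1
    have : (2 * (s : ℝ) - ((0 : I) : ℝ)) / (2 - ((0 : I) : ℝ)) = s := by simp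
    rw [this, clampI_coe]

theorem drag_eq_of_const {δ ω : I → Y} {c : Y} (hδ : ∀ r, δ r = c) (hω : ∀ r, ω r = c)
    (t s : I) : drag δ ω t s = c := by
  unfold drag
  split_ifs <;> simp [hδ, hω]

/-- Both branches give the common initial point when 2s = t, and the denominator 2 - t is at least
1. The part along `δ` takes parameter time t/2, so it disappears continuously as t tends to 0. -/
theorem continuous_drag {Z : Type*} [TopologicalSpace Z] [TopologicalSpace Y]
    {δ ω : Z → I → Y} {t s : Z → I} (hδ : Continuous fun p : Z × I => δ p.1 p.2)
    (hω : Continuous fun p : Z × I => ω p.1 p.2) (ht : Continuous t) (hs : Continuous s)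
    (h : ∀ z, δ z 0 = ω z 0) : Continuous fun z => drag (δ z) (ω z) (t z) (s z) := by
  have hpos : ∀ z, (2 : ℝ) - t z ≠ 0 := fun z => by have := (t z).2.2; linarith
  refine Continuous.if_le ?_ ?_ (by fun_prop) (by fun_prop) ?_
  · exact hδ.comp (continuous_id.prodMk (continuous_clampI.comp (by fun_prop)))
  · exact hω.comp (continuous_id.prodMk (continuous_clampI.comp
      ((by fun_prop : Continuous fun z => 2 * (s z : ℝ) - t z).div (by fun_prop) hpos)))
  · intro z hz
    simp only [hz, sub_self, zero_div]
    simpa [clampI] using h z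

end Drag

/-! ### Homotopy equivalences relative to distinguished subsets -/

/-- A map `f : X → Y` with `f(S) ⊆ T` is a homotopy equivalence relative to `S` and `T`: it has a
homotopy inverse `g` with `g(T) ⊆ S`, through homotopies that are stationary on `S` and `T`. -/
def IsRelHEquiv {X Y : Type*} [TopologicalSpace X] [TopologicalSpace Y] (S : Set X) (T : Set Y)
    (f : C(X, Y)) : Prop :=
  Set.MapsTo f S T ∧ ∃ g : C(Y, X), Set.MapsTo g T S ∧
    (g.comp f).HomotopicRel (ContinuousMap.id X) S ∧
    (f.comp g).HomotopicRel (ContinuousMap.id Y) T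

theorem ContinuousMap.HomotopicRel.precomp {X Y Z : Type*} [TopologicalSpace X]
    [TopologicalSpace Y] [TopologicalSpace Z] {S : Set X} {T : Set Y} {f g : C(Y, Z)}
    (h : f.HomotopicRel g T) (k : C(X, Y)) (hk : Set.MapsTo k S T) :
    (f.comp k).HomotopicRel (g.comp k) S := by
  obtain ⟨H⟩ := h
  exact ⟨⟨H.toHomotopy.compContinuousMap k, fun t x hx => H.eq_fst t (hk hx)⟩⟩

theorem FreeTop.isHEquiv_iff {X Y : Type u} [TopologicalSpace X] [TopologicalSpace Y]
    {f : C(X, Y)} : FreeTop.IsHEquiv f ↔ IsRelHEquiv ∅ ∅ f := by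
  constructor
  · rintro ⟨e, rfl⟩
    exact ⟨Set.mapsTo_empty _ _, e.invFun, Set.mapsTo_empty _ _,
      ContinuousMap.homotopicRel_empty.2 e.left_inv,
      ContinuousMap.homotopicRel_empty.2 e.right_inv⟩
  · rintro ⟨-, g, -, h₁, h₂⟩
    exact ⟨⟨f, g, h₁.homotopic, h₂.homotopic⟩, rfl⟩

theorem WPSpace.isPointedHEquiv_iff {X Y : Type u} [TopologicalSpace X] [TopologicalSpace Y]
    {x₀ : X} {y₀ : Y} {f : C(X, Y)} :
    WPSpace.IsPointedHEquiv x₀ y₀ f ↔ IsRelHEquiv {x₀} {y₀} f := by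
  simp [WPSpace.IsPointedHEquiv, IsRelHEquiv]

/-! ### Maps into and between standard homotopy pullbacks -/

namespace StdHPullback

variable {X A Y Z : Type u} [TopologicalSpace X] [TopologicalSpace A] [TopologicalSpace Y]
  [TopologicalSpace Z]

/-- The projection to `A`. -/
def snd (f : C(X, Y)) (ι : C(A, Y)) : C(StdHPullback f ι, A) where
  toFun z := z.1.2.2
  continuous_toFun := by
    exact continuous_snd.comp (continuous_snd.comp continuous_subtype_val)

/-- The path component of a point of the standard homotopy pullback. -/
def path {f : C(X, Y)} {ι : C(A, Y)} (z : StdHPullback f ι) : C(I, Y) := z.1.2.1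

theorem continuous_path (f : C(X, Y)) (ι : C(A, Y)) :
    Continuous (path : StdHPullback f ι → C(I, Y)) :=
  continuous_fst.comp (continuous_snd.comp continuous_subtype_val)

theorem continuous_path_apply {f : C(X, Y)} {ι : C(A, Y)} {z : Z → StdHPullback f ι} {s : Z → I}
    (hz : Continuous z) (hs : Continuous s) : Continuous fun p => (z p).path (s p) :=
  ((continuous_path f ι).comp hz).eval hs

variable {f : C(X, Y)} {ι : C(A, Y)}

@[simp] theorem path_zero (z : StdHPullback f ι) : z.path 0 = f (fst f ι z) := z.2.1

@[simp] theorem path_one (z : StdHPullback f ι) : z.path 1 = ι (snd f ι z) := z.2.2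

theorem eq_iff_components {z w : StdHPullback f ι} :
    z = w ↔ fst f ι z = fst f ι w ∧ (∀ s, z.path s = w.path s) ∧ snd f ι z = snd f ι w := by
  constructor
  · rintro rfl; simp
  · rintro ⟨h₁, h₂, h₃⟩
    exact Subtype.ext (Prod.ext h₁ (Prod.ext (ContinuousMap.ext h₂) h₃))

/-- The map into the standard homotopy pullback with prescribed components. -/
def lift (x : C(Z, X)) (w : C(Z × I, Y)) (a : C(Z, A)) (h₀ : ∀ z, w (z, 0) = f (x z))
    (h₁ : ∀ z, w (z, 1) = ι (a z)) : C(Z, StdHPullback f ι) where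
  toFun z := ⟨(x z, w.curry z, a z), h₀ z, h₁ z⟩
  continuous_toFun := Continuous.subtype_mk
    (x.continuous.prodMk (w.curry.continuous.prodMk a.continuous)) _

/-- The points of the standard homotopy pullback with a constant path and with ends in
prescribed subsets. -/
def base (f : C(X, Y)) (ι : C(A, Y)) (S : Set X) (T : Set A) : Set (StdHPullback f ι) :=
  {z | fst f ι z ∈ S ∧ snd f ι z ∈ T ∧ ∀ s, z.path s = f (fst f ι z)}

theorem homotopicRel_of_components {φ ψ : C(Z, StdHPullback f ι)} {S : Set Z}
    (x : C(I × Z, X)) (w : C((I × Z) × I, Y)) (a : C(I × Z, A))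
    (h₀ : ∀ p, w (p, 0) = f (x p)) (h₁ : ∀ p, w (p, 1) = ι (a p))
    (hφ : ∀ z, x (0, z) = fst f ι (φ z) ∧ (∀ s, w ((0, z), s) = (φ z).path s) ∧
      a (0, z) = snd f ι (φ z))
    (hψ : ∀ z, x (1, z) = fst f ι (ψ z) ∧ (∀ s, w ((1, z), s) = (ψ z).path s) ∧
      a (1, z) = snd f ι (ψ z))
    (hS : ∀ t, ∀ z ∈ S, x (t, z) = fst f ι (φ z) ∧ (∀ s, w ((t, z), s) = (φ z).path s) ∧
      a (t, z) = snd f ι (φ z)) : φ.HomotopicRel ψ S :=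
  ⟨⟨⟨lift x w a h₀ h₁, fun z => eq_iff_components.2 (hφ z), fun z => eq_iff_components.2 (hψ z)⟩,
    fun t z hz => eq_iff_components.2 (hS t z hz)⟩⟩

/-- The map of homotopy pullbacks induced by a map `u : Z → X`. -/
def pre (u : C(Z, X)) (f : C(X, Y)) (ι : C(A, Y)) :
    C(StdHPullback (f.comp u) ι, StdHPullback f ι) :=
  lift (u.comp (fst _ _)) ⟨fun p => p.1.path p.2, continuous_path_apply (by fun_prop)
    (by fun_prop)⟩ (snd _ _) (fun z => z.path_zero) (fun z => z.path_one)

theorem mapsTo_pre (u : C(Z, X)) (f : C(X, Y)) (ι : C(A, Y)) {R : Set Z} {S : Set X} (T : Set A)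
    (hu : Set.MapsTo u R S) :
    Set.MapsTo (pre u f ι) (base (f.comp u) ι R T) (base f ι S T) :=
  fun _ hz => ⟨hu hz.1, hz.2.1, hz.2.2⟩

/-- Transport of homotopy pullbacks along a homotopy. -/
noncomputable def transport {f₀ f₁ : C(X, Y)} (K : f₀.Homotopy f₁) (ι : C(A, Y)) :
    C(StdHPullback f₁ ι, StdHPullback f₀ ι) :=
  lift (fst _ _)
    -- The track of `K` is reversed because `drag` needs it to start where the path starts, at the
    -- value of `f₁`; the time 1 prefixes the whole track.
    ⟨fun p => drag (fun r => K (σ r, fst _ _ p.1)) p.1.path 1 p.2, by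
      refine continuous_drag ?_ ?_ (by fun_prop) (by fun_prop) (by simp)
      · fun_prop
      · exact continuous_path_apply (by fun_prop) (by fun_prop)⟩
    (snd _ _) (fun z => by simp [drag_source]) (fun z => by simp [drag_target])

theorem path_transport {f₀ f₁ : C(X, Y)} (K : f₀.Homotopy f₁) (z : StdHPullback f₁ ι) (s : I) :
    (transport K ι z).path s = drag (fun r => K (σ r, fst _ _ z)) z.path 1 s := rfl

theorem mapsTo_transport {f₀ f₁ : C(X, Y)} {S : Set X} (K : f₀.HomotopyRel f₁ S) (ι : C(A, Y))
    (T : Set A) :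
    Set.MapsTo (transport K.toHomotopy ι) (base f₁ ι S T) (base f₀ ι S T) := by
  rintro z ⟨h₁, h₂, h₃⟩
  refine ⟨h₁, h₂, fun s => ?_⟩
  rw [path_transport]
  refine drag_eq_of_const (fun r => K.eq_fst _ h₁) (fun r => ?_) _ _
  rw [h₃, ← K.fst_eq_snd h₁]

/-- The composite prefixes each path with a track run out and back. Going out only up to time t
contracts this detour. -/
theorem transport_symm_comp_transport {f₀ f₁ : C(X, Y)} {S : Set X} (K : f₀.HomotopyRel f₁ S)
    (ι : C(A, Y)) (T : Set A) :
    ((transport K.symm.toHomotopy ι).comp (transport K.toHomotopy ι)).HomotopicRel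
      (ContinuousMap.id _) (base f₁ ι S T) := by
  refine (homotopicRel_of_components ((fst _ _).comp ContinuousMap.snd)
    -- The outer track starts where the inner dragged path starts, at time t of the reversed track,
    -- and leads back to its time 0.
    ⟨fun p => drag (fun r => K (σ (clampI (p.1.1 - r)), fst _ _ p.1.2))
      (fun s => drag (fun r => K (σ r, fst _ _ p.1.2)) p.1.2.path p.1.1 s) p.1.1 p.2, ?_⟩
    ((snd _ _).comp ContinuousMap.snd) ?_ ?_ ?_ ?_ ?_).symm
  · refine continuous_drag ?_ ?_ (by fun_prop) (by fun_prop) ?_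
    · exact K.continuous.comp (Continuous.prodMk (unitInterval.continuous_symm.comp
        (continuous_clampI.comp (by fun_prop))) (by fun_prop))
    · refine continuous_drag ?_ ?_ (by fun_prop) (by fun_prop) (by simp)
      · fun_prop
      · exact continuous_path_apply (by fun_prop) (by fun_prop)
    · intro p
      simp [drag_source]
  · intro p; simp [drag_source]
  · intro p; simp [drag_target]
  · intro z
    refine ⟨rfl, fun s => ?_, rfl⟩
    have h : (fun r => K (σ r, fst _ _ z)) 0 = z.path 0 := by simp
    simp only [ContinuousMap.coe_mk]
    rw [drag_zero (by simp [drag_source]), drag_zero h]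
    rfl
  · intro z
    refine ⟨rfl, fun s => ?_, rfl⟩
    have h : ∀ r : I, clampI (((1 : I) : ℝ) - r) = σ r := fun r => by
      rw [show (((1 : I) : ℝ) - r) = ((σ r : I) : ℝ) by simp, clampI_coe]
    simp only [ContinuousMap.coe_mk, h]
    rfl
  · rintro t z ⟨h₁, h₂, h₃⟩
    refine ⟨rfl, fun s => ?_, rfl⟩
    have hK : ∀ r, K (r, fst _ _ z) = z.path s := fun r => by rw [K.eq_snd _ h₁, h₃]
    exact drag_eq_of_const (fun r => hK _)
      (fun r => drag_eq_of_const (fun r => hK _) (fun r => by rw [h₃, h₃]) _ _) _ _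

/-- A self-map `u` homotopic to the identity induces a map of homotopy pullbacks that has a right
homotopy inverse. -/
theorem pre_comp_transport {S : Set X} {u : C(X, X)}
    (K : u.HomotopyRel (ContinuousMap.id X) S) (f : C(X, Y)) (ι : C(A, Y)) (T : Set A) :
    ((pre u f ι).comp (transport
      ((K.compContinuousMap f).cast rfl f.comp_id).toHomotopy ι)).HomotopicRel
      (ContinuousMap.id _) (base f ι S T) := by
  refine (homotopicRel_of_components
    -- The point of X moves along `K` from x to u x, while its path is prefixed by the image of the
    -- part of the track already covered.
    ⟨fun p => K (σ p.1, fst _ _ p.2), by fun_prop⟩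
    ⟨fun p => drag (fun r => f (K (σ r, fst _ _ p.1.2))) p.1.2.path p.1.1 p.2, ?_⟩
    ((snd _ _).comp ContinuousMap.snd) ?_ ?_ ?_ ?_ ?_).symm
  · refine continuous_drag ?_ ?_ (by fun_prop) (by fun_prop) (by simp)
    · fun_prop
    · exact continuous_path_apply (by fun_prop) (by fun_prop)
  · intro p; simp [drag_source]
  · intro p; simp [drag_target]
  · intro z
    have h : (fun r => f (K (σ r, fst _ _ z))) 0 = z.path 0 := by simp
    exact ⟨by simp, fun s =>
      drag_zero (δ := fun r => f (K (σ r, fst _ _ z))) (ω := z.path) h s, rfl⟩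
  · intro z
    exact ⟨by simp; rfl, fun s => rfl, rfl⟩
  · rintro t z ⟨h₁, h₂, h₃⟩
    have hK : ∀ r, K (r, fst _ _ z) = fst _ _ z := fun r => K.eq_snd _ h₁
    refine ⟨hK _, fun s => ?_, rfl⟩
    have hf : ∀ r, f (K (σ r, fst _ _ z)) = z.path s := fun r => by rw [hK, h₃]
    have hz : ∀ r, z.path r = z.path s := fun r => by rw [h₃, h₃]
    exact drag_eq_of_const hf hz _ _

/-- The canonical section of the projection from the homotopy pullback of the identity. -/
def constSection (ι : C(A, Y)) : C(A, StdHPullback (ContinuousMap.id Y) ι) :=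
  lift ι ⟨fun p => ι p.1, by fun_prop⟩ (ContinuousMap.id A) (fun _ => rfl) (fun _ => rfl)

/-- The initial end slides along the path to its terminal end: at time t the path is reparametrized
by 1 - (1 - t)(1 - s). -/
theorem constSection_comp_snd (ι : C(A, Y)) (S : Set Y) (T : Set A) :
    ((constSection ι).comp (snd _ ι)).HomotopicRel (ContinuousMap.id _)
      (base (ContinuousMap.id Y) ι S T) := by
  refine (homotopicRel_of_components
    ⟨fun p => p.2.path p.1, continuous_path_apply (by fun_prop) (by fun_prop)⟩
    ⟨fun p => p.1.2.path (σ (σ p.1.1 * σ p.2)),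
      continuous_path_apply (by fun_prop) (by fun_prop)⟩
    ((snd _ _).comp ContinuousMap.snd) ?_ ?_ ?_ ?_ ?_).symm
  · intro p; simp
  · intro p; simp
  · intro z
    exact ⟨by simp, fun s => by simp, rfl⟩
  · intro z
    exact ⟨z.path_one, fun s => by simp; rfl, rfl⟩
  · rintro t z ⟨h₁, h₂, h₃⟩
    exact ⟨h₃ t, fun s => by simp [h₃], rfl⟩

/-- The base change of a homotopy equivalence is a homotopy equivalence. -/
theorem isRelHEquiv_snd {S : Set X} {R : Set Y} {T : Set A} (hf : IsRelHEquiv S R f)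
    (hι : Set.MapsTo ι T R) : IsRelHEquiv (base f ι S T) T (snd f ι) := by
  obtain ⟨hfS, g, hg, ⟨K⟩, ⟨L⟩⟩ := hf
  let ρ : C(A, StdHPullback (f.comp g) ι) := (transport L.toHomotopy ι).comp (constSection ι)
  have hρ : Set.MapsTo ρ T (base (f.comp g) ι R T) :=
    (mapsTo_transport L ι T).comp fun a ha => ⟨hι ha, ha, fun _ => rfl⟩
  have hρ' : (ρ.comp (snd (f.comp g) ι)).HomotopicRel (ContinuousMap.id _)
      (base (f.comp g) ι R T) :=
    -- Transport does not change the component in A, so `ρ` after the projection is the conjugate by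
    -- transport of `constSection` after the projection.
    (((constSection_comp_snd ι R T).comp_continuousMap (transport L.toHomotopy ι)).precomp
      (transport L.symm.toHomotopy ι) (mapsTo_transport L.symm ι T)).trans
      (by simpa only [ContinuousMap.HomotopyRel.symm_symm] using!
        transport_symm_comp_transport L.symm ι T)
  let w : C(StdHPullback f ι, StdHPullback (f.comp (g.comp f)) ι) :=
    transport ((K.compContinuousMap f).cast rfl f.comp_id).toHomotopy ι
  let v : C(StdHPullback f ι, StdHPullback (f.comp g) ι) := (pre f (f.comp g) ι).comp w
  have hv : Set.MapsTo v (base f ι S T) (base (f.comp g) ι R T) :=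
    (mapsTo_pre f (f.comp g) ι T hfS).comp (mapsTo_transport
      ((K.compContinuousMap f).cast rfl f.comp_id) ι T)
  have hgv : ((pre g f ι).comp v).HomotopicRel (ContinuousMap.id _) (base f ι S T) :=
    pre_comp_transport K f ι T
  have h₁ : (((pre g f ι).comp (ρ.comp (snd (f.comp g) ι))).comp v).HomotopicRel
      ((pre g f ι).comp v) (base f ι S T) :=
    (hρ'.comp_continuousMap (pre g f ι)).precomp v hv
  -- The map induced by `g` needs only the right inverse `v`: the projection after the new section
  -- is strictly the identity, so `K` and `L` need no compatibility.
  exact ⟨fun z hz => hz.2.1, (pre g f ι).comp ρ, (mapsTo_pre g f ι T hg).comp hρ,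
    h₁.trans hgv, ContinuousMap.HomotopicRel.refl _⟩

variable {B : Type u} [TopologicalSpace B]

/-- Two-out-of-three for `snd` ∘ `whisker` = `ζ`. The inverse is `ξ` ∘ `snd`, with `ξ` inverse to
`ζ`. -/
theorem isRelHEquiv_whisker {Q : Set B} {S : Set X} {R : Set Y} {T : Set A} {κ : C(B, X)}
    {ζ : C(B, A)} (H : (f.comp κ).HomotopyRel (ι.comp ζ) Q) (hf : IsRelHEquiv S R f)
    (hζ : IsRelHEquiv Q T ζ) (hκ : Set.MapsTo κ Q S) (hι : Set.MapsTo ι T R) :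
    IsRelHEquiv Q (base f ι S T)
      (whisker (f := f) (ι := ι) (q := κ) (p := ζ) H.toHomotopy) := by
  set w := whisker (f := f) (ι := ι) (q := κ) (p := ζ) H.toHomotopy
  have hwQ : Set.MapsTo w Q (base f ι S T) :=
    fun b hb => ⟨hκ hb, hζ.1 hb, fun s => H.eq_fst s hb⟩
  obtain ⟨hs, j, hj, hj₁, -⟩ := isRelHEquiv_snd hf hι
  obtain ⟨hζQ, ξ, hξ, hξ₁, hξ₂⟩ := hζ
  refine ⟨hwQ, ξ.comp (snd f ι), hξ.comp hs, hξ₁, ?_⟩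
  have h₁ : ((j.comp (snd f ι)).comp (w.comp (ξ.comp (snd f ι)))).HomotopicRel
      (w.comp (ξ.comp (snd f ι))) (base f ι S T) :=
    hj₁.precomp _ (hwQ.comp (hξ.comp hs))
  have h₂ : ((j.comp (ζ.comp ξ)).comp (snd f ι)).HomotopicRel (j.comp (snd f ι))
      (base f ι S T) :=
    (hξ₂.comp_continuousMap j).precomp _ hs
  exact h₁.symm.trans (h₂.trans hj₁)

theorem whisker_path_eq_id (H : (f.comp (fst f ι)).Homotopy (ι.comp (snd f ι)))
    (hH : ∀ t z, H (t, z) = z.path t) : whisker H = ContinuousMap.id _ := by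
  ext z
  exact eq_iff_components.2 ⟨rfl, fun s => hH s z, rfl⟩

/-- The tautological homotopy of the standard homotopy pullback. -/
def homotopy (f : C(X, Y)) (ι : C(A, Y)) :
    (f.comp (fst f ι)).HomotopyRel (ι.comp (snd f ι)) {z | ∀ s, z.path s = f (fst f ι z)} where
  toFun p := p.2.path p.1
  continuous_toFun := continuous_path_apply (by fun_prop) (by fun_prop)
  map_zero_left z := z.path_zero
  map_one_left z := z.path_one
  prop' t _ hz := hz t

end StdHPullback

/-! ### Well-pointed spaces and contracting neighbourhoods of the base point -/

/-- A function `u` vanishing at `x₀` and a homotopy `h` of the identity that has moved every `x`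
to `x₀` at the time `u x` (if `u x ≤ 1`). -/
structure PointNDR {X : Type u} [TopologicalSpace X] (x₀ : X) where
  /-- the function measuring the distance to the base point -/
  u : C(X, ℝ)
  /-- the contracting homotopy -/
  h : C(X × I, X)
  u_nonneg : ∀ x, 0 ≤ u x
  u_pt : u x₀ = 0
  h_zero : ∀ x, h (x, 0) = x
  h_eq : ∀ x (t : I), u x ≤ t → h (x, t) = x₀

namespace PointNDR

variable {X : Type u} [TopologicalSpace X] {x₀ : X} (N : PointNDR x₀)

include N in
theorem isClosed_pt : IsClosed ({x₀} : Set X) := by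
  have : ({x₀} : Set X) = N.u ⁻¹' {0} := by
    ext x
    simp only [Set.mem_singleton_iff, Set.mem_preimage]
    exact ⟨fun h => h ▸ N.u_pt, fun h => by rw [← N.h_zero x, N.h_eq x 0 (by simp [h])]⟩
  rw [this]
  exact isClosed_singleton.preimage N.u.continuous

theorem h_pt (t : I) : N.h (x₀, t) = x₀ := N.h_eq _ _ (N.u_pt ▸ t.2.1)

-- To extend `G`, follow `g` along the contraction until time u x, when x has reached the base
-- point, and then follow `G` for the remaining time t - u x.
include N in
theorem isClosedCofibration : IsClosedCofibration (ContinuousMap.const PUnit.{u + 1} x₀) := by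
  refine ⟨?_, fun Z _ g G hG => ?_⟩
  · refine Topology.IsClosedEmbedding.of_continuous_injective_isClosedMap
      (ContinuousMap.continuous _) (Function.injective_of_subsingleton _) fun s _ => ?_
    rcases s.eq_empty_or_nonempty with rfl | hs
    · simp
    · have : (ContinuousMap.const PUnit.{u + 1} x₀ : PUnit → X) '' s = {x₀} := by
        exact hs.image_const x₀
      rw [this]
      exact N.isClosed_pt
  · refine ⟨⟨fun p => if (p.2 : ℝ) ≤ N.u p.1 then g (N.h p)
      else G (PUnit.unit, clampI (p.2 - N.u p.1)), ?_⟩, ?_, ?_⟩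
    · refine Continuous.if_le (by fun_prop) ?_ (by fun_prop) (by fun_prop) ?_
      · exact G.continuous.comp (continuous_const.prodMk (continuous_clampI.comp (by fun_prop)))
      · rintro ⟨x, t⟩ hxt
        dsimp only at hxt ⊢
        rw [N.h_eq x t hxt.ge, hxt, sub_self]
        have := hG PUnit.unit
        simpa [clampI] using this.symm
    · intro x
      simp [N.u_nonneg x, N.h_zero]
    · rintro ⟨⟩ t
      simp only [ContinuousMap.coe_mk, ContinuousMap.const_apply, N.u_pt, sub_zero, clampI_coe]
      split_ifs with ht
      · have : t = 0 := le_antisymm ht t.2.1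
        rw [this, N.h_zero, hG]; rfl
      · rfl

end PointNDR

/-- Homotopy extension gives a retraction of X × I onto X × 0 ∪ {x₀} × I. Its first coordinate is
the contraction; the largest displacement v x of its second coordinate bounds the time needed, since
t > v x makes that coordinate nonzero. -/
theorem IsClosedCofibration.nonempty_pointNDR {X : Type u} [TopologicalSpace X] {x₀ : X}
    (hx : IsClosedCofibration (ContinuousMap.const PUnit.{u + 1} x₀)) :
    Nonempty (PointNDR x₀) := by
  have hcl : IsClosed ({x₀} : Set X) := by
    have h : Set.range (ContinuousMap.const PUnit.{u + 1} x₀) = {x₀} := Set.range_const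
    exact h ▸ hx.1.isClosed_range
  obtain ⟨F, hF₀, hF₁⟩ := hx.2 {p : X × I // p.2 = 0 ∨ p.1 = x₀}
    ⟨fun x => ⟨(x, 0), Or.inl rfl⟩, Continuous.subtype_mk (by fun_prop) _⟩
    ⟨fun p => ⟨(x₀, p.2), Or.inr rfl⟩, Continuous.subtype_mk (by fun_prop) _⟩
    (fun _ => rfl)
  have hc₁ : Continuous fun p : X × I => (F p).1.1 := by fun_prop
  let d : X → I → ℝ := fun x t => |(t : ℝ) - (F (x, t)).1.2|
  have hd : Continuous ↿d := by
    change Continuous fun p : X × I => |(p.2 : ℝ) - (F p).1.2|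
    fun_prop
  have hdx : ∀ x, Continuous (d x) := fun x => hd.comp (Continuous.prodMk_right x)
  let v : X → ℝ := fun x => sSup (d x '' Set.univ)
  have hv : Continuous v := isCompact_univ.continuous_sSup hd
  have hle : ∀ x t, d x t ≤ v x := fun x t =>
    le_csSup (isCompact_univ.bddAbove_image (hdx x).continuousOn) ⟨t, trivial, rfl⟩
  have hv0 : ∀ x, 0 ≤ v x := fun x => (abs_nonneg _).trans (hle x 0)
  have hmove : ∀ x (t : I), v x < t → (F (x, t)).1.1 = x₀ := by
    intro x t hxt
    refine (F (x, t)).2.resolve_left fun h0 => ?_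
    have := hle x t
    simp only [d, h0, Set.Icc.coe_zero, sub_zero, abs_of_nonneg t.2.1] at this
    linarith
  -- The factor 2 turns the strict bound v x < t into a non-strict one when v x > 0. When v x = 0,
  -- the time t = 0 is reached by closedness of the base point.
  refine ⟨⟨⟨fun x => 2 * v x, by fun_prop⟩, ⟨fun p => (F p).1.1, hc₁⟩, ?_, ?_, ?_, ?_⟩⟩
  · exact fun x => mul_nonneg zero_le_two (hv0 x)
  · have : d x₀ '' Set.univ = {0} := by
      have : ∀ t, d x₀ t = 0 := fun t => by
        have := hF₁ PUnit.unit t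
        simp only [ContinuousMap.const_apply] at this
        simp [d, this]
      ext r
      simp [this]
    simp only [ContinuousMap.coe_mk, v, this, csSup_singleton, mul_zero]
  · intro x
    simp [hF₀]
  · intro x t hxt
    simp only [ContinuousMap.coe_mk] at hxt ⊢
    rcases (hv0 x).eq_or_lt with h0 | h0
    · have hsub : {t : I | (0 : ℝ) < t} ⊆ {t | (F (x, t)).1.1 = x₀} :=
        fun t ht => hmove x t (h0 ▸ ht)
      have hclosed : IsClosed {t : I | (F (x, t)).1.1 = x₀} :=
        hcl.preimage (hc₁.comp (Continuous.prodMk_right x))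
      have hdense : Dense {t : I | (0 : ℝ) < t} := by
        have : {t : I | (0 : ℝ) < t} = {0}ᶜ := by
          ext t
          simp [unitInterval.pos_iff_ne_zero.symm]
        rw [this]
        exact dense_compl_singleton 0
      have := hclosed.closure_subset_iff.2 hsub
      rw [hdense.closure_eq] at this
      exact this (Set.mem_univ t)
    · exact hmove x t (by linarith)

/-! ### Contracting the standard homotopy pullback to its base point -/

namespace StdHPullback

variable {X A Y : Type u} [TopologicalSpace X] [TopologicalSpace A] [TopologicalSpace Y]

/-- The path of `z`, extended at both ends along the tracks up to the time `t` of homotopies in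
the two end spaces. -/
noncomputable def trackPath {f : C(X, Y)} {ι : C(A, Y)} (hX : C(X × I, X)) (hA : C(A × I, A))
    (z : StdHPullback f ι) (t s : I) : Y :=
  drag (fun r => ι (hA (snd f ι z, r)))
    (fun s => drag (fun r => f (hX (fst f ι z, r))) z.path t (σ s)) t (σ s)

section TrackPath

variable {f : C(X, Y)} {ι : C(A, Y)} {hX : C(X × I, X)} {hA : C(A × I, A)}

theorem trackPath_source (z : StdHPullback f ι) (t : I) :
    trackPath hX hA z t 0 = f (hX (fst f ι z, t)) := by
  simp [trackPath, drag_target, drag_source]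

theorem trackPath_target (z : StdHPullback f ι) (t : I) :
    trackPath hX hA z t 1 = ι (hA (snd f ι z, t)) := by
  simp [trackPath, drag_source]

variable (hX0 : ∀ x, hX (x, 0) = x) (hA0 : ∀ a, hA (a, 0) = a)
include hX0 hA0

theorem trackPath_zero (z : StdHPullback f ι) (s : I) : trackPath hX hA z 0 s = z.path s := by
  have h : (fun r => f (hX (fst f ι z, r))) 0 = z.path 0 := by simp [hX0]
  unfold trackPath
  rw [drag_zero]
  · rw [drag_zero h, unitInterval.symm_symm]
  · simp [drag_target, hA0]

theorem continuous_trackPath {Z : Type u} [TopologicalSpace Z] {z : Z → StdHPullback f ι}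
    {t s : Z → I} (hz : Continuous z) (ht : Continuous t) (hs : Continuous s) :
    Continuous fun p => trackPath hX hA (z p) (t p) (s p) := by
  refine continuous_drag (by fun_prop) ?_ ht (by fun_prop) (by simp [drag_target, hA0])
  refine continuous_drag (by fun_prop) ?_ (by fun_prop) (by fun_prop) (by simp [hX0])
  exact continuous_path_apply (by fun_prop) (by fun_prop)

end TrackPath

end StdHPullback

namespace WPSpace

open StdHPullback

variable {X A Y : WPSpace.{u}}

theorem base_singleton (f : Map X Y) (ι : Map A Y) :
    base f.map ι.map {X.pt} {A.pt} = {stdBase f ι} := by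
  ext z
  rw [Set.mem_singleton_iff, eq_iff_components]
  constructor
  · rintro ⟨h₁, h₂, h₃⟩
    exact ⟨h₁, fun s => (h₃ s).trans ((congrArg f.map h₁).trans f.map_pt), h₂⟩
  · rintro ⟨h₁, h₂, h₃⟩
    exact ⟨h₁, h₃, fun s => (h₂ s).trans ((congrArg f.map h₁).trans f.map_pt).symm⟩

/-- The base point of the standard homotopy pullback of well-pointed spaces is nondegenerate. -/
theorem nonempty_pointNDR_stdBase (f : Map X Y) (ι : Map A Y) :
    Nonempty (PointNDR (stdBase f ι)) := by
  obtain ⟨NX⟩ := X.wellPointed.nonempty_pointNDR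
  obtain ⟨NA⟩ := A.wellPointed.nonempty_pointNDR
  obtain ⟨NY⟩ := Y.wellPointed.nonempty_pointNDR
  let P := StdHPullback f.map ι.map
  let m : C(P, ℝ) := ⟨fun z => max (NX.u (fst _ _ z)) (NA.u (snd _ _ z)), by fun_prop⟩
  have hm0 : ∀ z, 0 ≤ m z := fun z => (NX.u_nonneg _).trans (le_max_left _ _)
  -- The contraction has two stages. Up to time m z the ends move to the base points of X and A,
  -- dragging the path along; then the path is a loop in Y, contracted pointwise for the time `ς`
  -- that is left.
  let τ : P × I → I := fun p => clampI (min p.2 (m p.1))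
  have hτ : Continuous τ := continuous_clampI.comp (by fun_prop)
  let ς : P × I → I := fun p => clampI (p.2 - m p.1)
  have hς : Continuous ς := continuous_clampI.comp (by fun_prop)
  have hτ0 : ∀ z, τ (z, 0) = 0 := fun z => by simp [τ, clampI, hm0 z]
  have hς0 : ∀ z, ς (z, 0) = 0 := fun z => by
    simp only [ς, Set.Icc.coe_zero, zero_sub]
    exact Set.projIcc_of_le_left _ (by simpa using hm0 z)
  -- The second stage starts only with both ends at base points. These map to the base point of Y,
  -- which `NY.h` fixes, so the end conditions persist.
  have hcases : ∀ p : P × I, ς p = 0 ∨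
      (NX.h (fst _ _ p.1, τ p) = X.pt ∧ NA.h (snd _ _ p.1, τ p) = A.pt) := by
    rintro ⟨z, t⟩
    rcases le_total (t : ℝ) (m z) with h | h
    · left
      exact Set.projIcc_of_le_left _ (by simpa using h)
    · right
      have : ((τ (z, t) : I) : ℝ) = m z := by
        simp only [τ, min_eq_right h]
        exact congrArg Subtype.val
          (Set.projIcc_of_mem zero_le_one ⟨hm0 z, h.trans t.2.2⟩)
      exact ⟨NX.h_eq _ _ (this ▸ le_max_left _ _), NA.h_eq _ _ (this ▸ le_max_right _ _)⟩
  have hYpt : ∀ p : P × I, ∀ y, (ς p = 0 ∨ y = Y.pt) → NY.h (y, ς p) = y := by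
    rintro p y (h | rfl)
    · rw [h, NY.h_zero]
    · exact NY.h_pt _
  let H : C(P × I, P) := lift
    ⟨fun p => NX.h (fst _ _ p.1, τ p), by fun_prop⟩
    ⟨fun p => NY.h (trackPath NX.h NA.h p.1.1 (τ p.1) p.2, ς p.1), NY.h.continuous.comp
      ((continuous_trackPath NX.h_zero NA.h_zero (by fun_prop) (by fun_prop)
        (by fun_prop)).prodMk (by fun_prop))⟩
    ⟨fun p => NA.h (snd _ _ p.1, τ p), by fun_prop⟩
    (fun p => by
      simp only [ContinuousMap.coe_mk, trackPath_source]
      exact hYpt p _ ((hcases p).imp_right fun h => by rw [h.1, f.map_pt]))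
    (fun p => by
      simp only [ContinuousMap.coe_mk, trackPath_target]
      exact hYpt p _ ((hcases p).imp_right fun h => by rw [h.2, ι.map_pt]))
  -- The supremum of `e z` is the time the second stage needs to contract every point of the loop,
  -- so m z + v z suffices in total.
  let e : P → I → ℝ := fun z s => NY.u (trackPath NX.h NA.h z (clampI (m z)) s)
  have he : Continuous ↿e := by
    refine NY.u.continuous.comp (continuous_trackPath NX.h_zero NA.h_zero (by fun_prop)
      (continuous_clampI.comp (by fun_prop)) (by fun_prop))
  have hez : ∀ z, Continuous (e z) := fun z => he.comp (Continuous.prodMk_right z)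
  let v : P → ℝ := fun z => sSup (e z '' Set.univ)
  have hv : Continuous v := isCompact_univ.continuous_sSup he
  have hle : ∀ z s, e z s ≤ v z := fun z s =>
    le_csSup (isCompact_univ.bddAbove_image (hez z).continuousOn) ⟨s, trivial, rfl⟩
  have hv0 : ∀ z, 0 ≤ v z := fun z => (NY.u_nonneg _).trans (hle z 0)
  have hpt : ∀ t s, trackPath NX.h NA.h (stdBase f ι) t s = Y.pt := fun t s =>
    drag_eq_of_const (fun r => (congrArg ι.map (NA.h_pt r)).trans ι.map_pt)
      (fun r => drag_eq_of_const (fun r => (congrArg f.map (NX.h_pt r)).trans f.map_pt)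
        (fun _ => rfl) _ _) _ _
  refine ⟨⟨⟨fun z => m z + v z, by fun_prop⟩, H, fun z => add_nonneg (hm0 z) (hv0 z), ?_, ?_, ?_⟩⟩
  · have hm : m (stdBase f ι) = 0 := by
      change max (NX.u X.pt) (NA.u A.pt) = 0
      rw [NX.u_pt, NA.u_pt, max_self]
    have : e (stdBase f ι) '' Set.univ = {0} := by
      have : ∀ s, e (stdBase f ι) s = 0 := fun s => by simp only [e, hpt, NY.u_pt]
      ext r
      simp [this]
    simp only [ContinuousMap.coe_mk, hm, v, this, csSup_singleton, add_zero]
  · intro z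
    refine eq_iff_components.2 ⟨?_, fun s => ?_, ?_⟩
    · change NX.h (_, τ (z, 0)) = _
      rw [hτ0, NX.h_zero]
    · change NY.h (trackPath NX.h NA.h z (τ (z, 0)) s, ς (z, 0)) = _
      rw [hτ0, hς0, NY.h_zero, trackPath_zero NX.h_zero NA.h_zero]
    · change NA.h (_, τ (z, 0)) = _
      rw [hτ0, NA.h_zero]
  · intro z t hzt
    simp only [ContinuousMap.coe_mk] at hzt
    have hmt : m z ≤ t := by linarith [hv0 z]
    have hτt : τ (z, t) = clampI (m z) := by simp only [τ, min_eq_right hmt]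
    have hmI : m z ∈ I := ⟨hm0 z, hmt.trans t.2.2⟩
    have hτm : ((τ (z, t) : I) : ℝ) = m z := by
      rw [hτt]; exact congrArg Subtype.val (Set.projIcc_of_mem zero_le_one hmI)
    have hςt : ((ς (z, t) : I) : ℝ) = t - m z :=
      congrArg Subtype.val (Set.projIcc_of_mem zero_le_one
        ⟨sub_nonneg.2 hmt, by linarith [hm0 z, t.2.2]⟩)
    refine eq_iff_components.2 ⟨NX.h_eq _ _ (hτm ▸ le_max_left _ _), fun s => ?_,
      NA.h_eq _ _ (hτm ▸ le_max_right _ _)⟩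
    refine NY.h_eq _ _ ?_
    have := hle z s
    dsimp only
    rw [hςt, hτt]
    change e z s ≤ _
    linarith

/-- The standard homotopy pullback as a well-pointed space. -/
def std (f : Map X Y) (ι : Map A Y) : WPSpace.{u} where
  carrier := StdHPullback f.map ι.map
  pt := stdBase f ι
  wellPointed := (nonempty_pointNDR_stdBase f ι).elim fun N => N.isClosedCofibration

theorem exists_isHPullback (f : Map X Y) (ι : Map A Y) :
    ∃ (P : WPSpace.{u}) (q : Map P X) (p : Map P A), IsHPullback q p f ι := by
  have hK : ∀ s, (stdBase f ι).path s = f.map (fst _ _ (stdBase f ι)) := fun s => f.map_pt.symm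
  refine ⟨std f ι, ⟨fst f.map ι.map, rfl⟩, ⟨snd f.map ι.map, rfl⟩,
    ⟨(homotopy f.map ι.map).toHomotopy, ?_⟩, ?_⟩
  · rintro t z rfl
    exact hK t
  · refine isPointedHEquiv_iff.2 ?_
    have : whisker (homotopy f.map ι.map).toHomotopy = ContinuousMap.id _ :=
      whisker_path_eq_id _ fun _ _ => rfl
    exact this ▸ ⟨fun z hz => hz, ContinuousMap.id _, fun z hz => hz,
      ContinuousMap.HomotopicRel.refl _, ContinuousMap.HomotopicRel.refl _⟩

/-! ### The lifting category in `Top^w` -/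

theorem isHPullback_of_isHEquiv {B : WPSpace.{u}} {κ : Map B X} {ζ : Map B A} {ι : Map A Y}
    {f : Map X Y} (h : (f.comp κ).Homotopic (ι.comp ζ)) (hf : f.IsHEquiv) (hζ : ζ.IsHEquiv) :
    IsHPullback κ ζ f ι := by
  obtain ⟨H⟩ := h
  refine ⟨H, isPointedHEquiv_iff.2 ?_⟩
  rw [← base_singleton]
  exact isRelHEquiv_whisker (R := {Y.pt}) H (isPointedHEquiv_iff.1 hf) (isPointedHEquiv_iff.1 hζ)
    (by simpa using κ.map_pt) (by simpa using ι.map_pt)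

theorem Map.Homotopic.precomp {Z : WPSpace.{u}} {f g : Map X Y} (h : f.Homotopic g)
    (k : Map Z X) : (f.comp k).Homotopic (g.comp k) :=
  ContinuousMap.HomotopicRel.precomp h k.map (by simpa using k.map_pt)

theorem Map.Homotopic.postcomp {Z : WPSpace.{u}} {f g : Map X Y} (h : f.Homotopic g)
    (k : Map Y Z) : (k.comp f).Homotopic (k.comp g) :=
  ContinuousMap.HomotopicRel.comp_continuousMap h k.map

theorem Map.Homotopic.symm {f g : Map X Y} (h : f.Homotopic g) : g.Homotopic f :=
  ContinuousMap.HomotopicRel.symm h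

theorem Map.Homotopic.trans {f g k : Map X Y} (h : f.Homotopic g) (h' : g.Homotopic k) :
    f.Homotopic k :=
  ContinuousMap.HomotopicRel.trans h h'

theorem IsHPullback.homotopic {P : WPSpace.{u}} {q : Map P X} {p : Map P A} {f : Map X Y}
    {ι : Map A Y} (h : IsHPullback q p f ι) : (f.comp q).Homotopic (ι.comp p) :=
  ⟨h.choose⟩

theorem SectionalCategory.liftcat_le (S : SectionalCategory.{u}) {B W : WPSpace.{u}}
    {κ : Map B X} {ζ : Map B A} {ι : Map A Y} {f : Map X Y} {g : Map W X} {h : Map W Y}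
    (hs : (f.comp κ).Homotopic (ι.comp ζ)) (hh : (f.comp g).Homotopic h) :
    S.liftcat h ι ≤ S.liftcat g κ := by
  obtain ⟨P, q, p, hP⟩ := exists_isHPullback h ι
  obtain ⟨P', q', p', hP'⟩ := exists_isHPullback g κ
  rw [S.liftcat_eq hP, S.liftcat_eq hP']
  obtain ⟨s, hs'⟩ := hP.exists_whisker q' (ζ.comp p')
    ((hh.symm.precomp q').trans ((hP'.homotopic.postcomp f).trans (hs.precomp p')))
  exact S.S1 _ _ s hs'

theorem SectionalCategory.liftcat_eq_of_isHPullback (S : SectionalCategory.{u})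
    {B W : WPSpace.{u}} {κ : Map B X} {ζ : Map B A} {ι : Map A Y} {f : Map X Y} {g : Map W X}
    {h : Map W Y} (hs : IsHPullback κ ζ f ι) (hh : (f.comp g).Homotopic h) :
    S.liftcat h ι = S.liftcat g κ := by
  refine le_antisymm (S.liftcat_le hs.homotopic hh) ?_
  obtain ⟨P, q, p, hP⟩ := exists_isHPullback h ι
  obtain ⟨P', q', p', hP'⟩ := exists_isHPullback g κ
  rw [S.liftcat_eq hP, S.liftcat_eq hP']
  -- Two lifts in succession: g q lifts through `κ` by the given square, and then `q` lifts through
  -- `q'`.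
  obtain ⟨b, hb⟩ := hs.exists_whisker (g.comp q) p ((hh.precomp q).trans hP.homotopic)
  obtain ⟨s, hs'⟩ := hP'.exists_whisker q b hb.symm
  exact S.S1 _ _ s hs'

end WPSpace

/-! ### The lifting category in `Top` -/

namespace FreeTop

open StdHPullback

variable {A B W X Y : Type u} [TopologicalSpace A] [TopologicalSpace B] [TopologicalSpace W]
  [TopologicalSpace X] [TopologicalSpace Y]

theorem isHPullback_std (f : C(X, Y)) (ι : C(A, Y)) :
    IsHPullback (fst f ι) (snd f ι) f ι := by
  refine ⟨(homotopy f ι).toHomotopy, ContinuousMap.HomotopyEquiv.refl _, ?_⟩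
  rw [whisker_path_eq_id _ fun _ _ => rfl]
  rfl

theorem isHPullback_of_isHEquiv {κ : C(B, X)} {ζ : C(B, A)} {ι : C(A, Y)} {f : C(X, Y)}
    (h : (f.comp κ).Homotopic (ι.comp ζ)) (hf : IsHEquiv f) (hζ : IsHEquiv ζ) :
    IsHPullback κ ζ f ι := by
  obtain ⟨H⟩ := ContinuousMap.homotopicRel_empty.2 h
  refine ⟨H.toHomotopy, isHEquiv_iff.2 ?_⟩
  have hb : base f ι ∅ ∅ = ∅ := Set.eq_empty_of_forall_notMem fun z hz => hz.1
  rw [← hb]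
  exact isRelHEquiv_whisker H (isHEquiv_iff.1 hf) (isHEquiv_iff.1 hζ) (Set.mapsTo_empty _ _)
    (Set.mapsTo_empty _ _)

theorem IsHPullback.homotopic {P : Type u} [TopologicalSpace P] {q : C(P, X)} {p : C(P, A)}
    {f : C(X, Y)} {ι : C(A, Y)} (h : IsHPullback q p f ι) :
    (f.comp q).Homotopic (ι.comp p) :=
  ⟨h.choose⟩

theorem SectionalCategory.liftcat_le (S : SectionalCategory.{u}) {κ : C(B, X)} {ζ : C(B, A)}
    {ι : C(A, Y)} {f : C(X, Y)} {g : C(W, X)} {h : C(W, Y)}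
    (hs : (f.comp κ).Homotopic (ι.comp ζ)) (hh : (f.comp g).Homotopic h) :
    S.liftcat h ι ≤ S.liftcat g κ := by
  have hP' := isHPullback_std g κ
  rw [S.liftcat_eq (isHPullback_std h ι), S.liftcat_eq hP']
  obtain ⟨s, hs'⟩ := (isHPullback_std h ι).exists_whisker (fst g κ) (ζ.comp (snd g κ))
    ((hh.symm.comp (.refl _)).trans
      (((ContinuousMap.Homotopic.refl f).comp hP'.homotopic).trans (hs.comp (.refl _))))
  exact S.S1 _ _ s hs'

theorem SectionalCategory.liftcat_eq_of_isHPullback (S : SectionalCategory.{u}) {κ : C(B, X)}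
    {ζ : C(B, A)} {ι : C(A, Y)} {f : C(X, Y)} {g : C(W, X)} {h : C(W, Y)}
    (hs : IsHPullback κ ζ f ι) (hh : (f.comp g).Homotopic h) :
    S.liftcat h ι = S.liftcat g κ := by
  refine le_antisymm (S.liftcat_le hs.homotopic hh) ?_
  rw [S.liftcat_eq (isHPullback_std h ι), S.liftcat_eq (isHPullback_std g κ)]
  obtain ⟨b, hb⟩ := hs.exists_whisker (g.comp (fst h ι)) (snd h ι)
    ((hh.comp (.refl (fst h ι))).trans (isHPullback_std h ι).homotopic)
  obtain ⟨s, hs'⟩ := (isHPullback_std g κ).exists_whisker (fst h ι) b hb.symm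
  exact S.S1 _ _ s hs'

end FreeTop

theorem mainTheorem6 :
    -- the category `Top`
    (∀ S : FreeTop.SectionalCategory.{u},
      (∀ (A B W X Y : Type u) [TopologicalSpace A] [TopologicalSpace B] [TopologicalSpace W]
        [TopologicalSpace X] [TopologicalSpace Y]
        (κ : C(B, X)) (ζ : C(B, A)) (ι : C(A, Y)) (f : C(X, Y)) (g : C(W, X)) (h : C(W, Y)),
        (f.comp κ).Homotopic (ι.comp ζ) → (f.comp g).Homotopic h →
          S.liftcat h ι ≤ S.liftcat g κ ∧
          (FreeTop.IsHPullback κ ζ f ι → S.liftcat h ι = S.liftcat g κ) ∧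
          (FreeTop.IsHEquiv f → FreeTop.IsHEquiv ζ →
            FreeTop.IsHPullback κ ζ f ι ∧ S.liftcat h ι = S.liftcat g κ)) ∧
      (∀ (A W Y : Type u) [TopologicalSpace A] [TopologicalSpace W] [TopologicalSpace Y]
        (g h : C(W, Y)) (ι κ : C(A, Y)), h.Homotopic g → ι.Homotopic κ →
          S.liftcat h ι = S.liftcat g κ)) ∧
    -- the category `Top^w`
    (∀ S : WPSpace.SectionalCategory.{u},
      (∀ (A B W X Y : WPSpace.{u})
        (κ : B.Map X) (ζ : B.Map A) (ι : A.Map Y) (f : X.Map Y) (g : W.Map X) (h : W.Map Y),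
        (f.comp κ).Homotopic (ι.comp ζ) → (f.comp g).Homotopic h →
          S.liftcat h ι ≤ S.liftcat g κ ∧
          (WPSpace.IsHPullback κ ζ f ι → S.liftcat h ι = S.liftcat g κ) ∧
          (f.IsHEquiv → ζ.IsHEquiv →
            WPSpace.IsHPullback κ ζ f ι ∧ S.liftcat h ι = S.liftcat g κ)) ∧
      (∀ (A W Y : WPSpace.{u}) (g h : W.Map Y) (ι κ : A.Map Y), h.Homotopic g → ι.Homotopic κ →
          S.liftcat h ι = S.liftcat g κ)) := by
  refine ⟨fun S => ⟨?_, ?_⟩, fun S => ⟨?_, ?_⟩⟩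
  · intro A B W X Y _ _ _ _ _ κ ζ ι f g h hs hh
    refine ⟨S.liftcat_le hs hh, fun hP => S.liftcat_eq_of_isHPullback hP hh, fun hf hζ => ?_⟩
    have hP := FreeTop.isHPullback_of_isHEquiv hs hf hζ
    exact ⟨hP, S.liftcat_eq_of_isHPullback hP hh⟩
  · intro A W Y _ _ _ g h ι κ hgh hικ
    -- Homotopic `ι` and `κ` form a square with identities on Y and A, in either direction; the
    -- inequality is applied to both.
    exact le_antisymm
      (S.liftcat_le (f := ContinuousMap.id Y) (ζ := ContinuousMap.id A) hικ.symm hgh.symm)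
      (S.liftcat_le (f := ContinuousMap.id Y) (ζ := ContinuousMap.id A) hικ hgh)
  · intro A B W X Y κ ζ ι f g h hs hh
    refine ⟨S.liftcat_le hs hh, fun hP => S.liftcat_eq_of_isHPullback hP hh, fun hf hζ => ?_⟩
    have hP := WPSpace.isHPullback_of_isHEquiv hs hf hζ
    exact ⟨hP, S.liftcat_eq_of_isHPullback hP hh⟩
  · intro A W Y g h ι κ hgh hικ
    exact le_antisymm
      (S.liftcat_le (f := WPSpace.Map.id Y) (ζ := WPSpace.Map.id A) hικ.symm hgh.symm)
      (S.liftcat_le (f := WPSpace.Map.id Y) (ζ := WPSpace.Map.id A) hικ hgh)
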